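/- Let $a \le b$ be real numbers, $\mathcal X = [a,b]$, and let $f : [a,b] \to \mathbb R^+ = [0,\infty)$ be continuous and not identically zero. An $\mathcal X$-algorithm is a pair of sequences of measurable functions $T_n : (0,1)\times\mathcal X^n \to \{0,1\}$ and $\phi_n : (0,1)\times\mathcal X^n \to [0,\infty)$, $n \ge 1$. On input $u \in (0,1)$ and $x = (x_k)_{k\ge 1} \in \mathcal X^\infty$ its output is $\mathcal A(u,x) = \phi_\tau(u,x_1,\dots,x_\tau)$, where $\tau = \inf\{n \ge 1 : T_n(u,x_1,\dots,x_n) = 1\}$, and $\mathcal A(u,x) = \infty$ if there is no such $n$. It is called an $f$-factory if $\mathbb E[\mathcal A(U,(X_k)_{k\ge1})] = f\left(\int x\,\pi(dx)\right)$ for every probability distribution $\pi$ on $\mathcal X$ with finite first moment, where $X_1, X_2, \dots$ are i.i.d. with law $\pi$ and $U$ is uniform on $(0,1)$ and independent of $(X_k)_{k\ge1}$. Then an $f$-factory exists if and only if there are $\varepsilon > 0$ and $n \in \mathbb N$ such that $$ f(x) \ge \varepsilon \min\left( (x-a)^n, (b-x)^n \right) \quad\text{for all } x \in [a,b]. $$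 -/

import Mathlib

open MeasureTheory Set
open scoped NNReal ENNReal

/-- The uniform distribution on `(0,1)`: Lebesgue measure on the subtype. -/
noncomputable def uniformUnit : Measure (Ioo (0 : ℝ) 1) :=
  Measure.comap Subtype.val (volume : Measure ℝ)

/-- An `X`-algorithm for `X ⊆ ℝ`: stopping rules `T n : (0,1) × Xⁿ → {0,1}` (here `Bool`) and
output functions `φ n : (0,1) × Xⁿ → [0,∞)`, all Borel measurable.
Only the indices `n ≥ 1` are ever used, see `XAlgorithm.StopsAt`. -/
structure XAlgorithm (X : Set ℝ) where
  T : (n : ℕ) → Ioo (0 : ℝ) 1 × (Fin n → X) → Bool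
  φ : (n : ℕ) → Ioo (0 : ℝ) 1 × (Fin n → X) → ℝ≥0
  measurable_T : ∀ n, Measurable (T n)
  measurable_φ : ∀ n, Measurable (φ n)

namespace XAlgorithm

variable {X : Set ℝ}

/-- `A.StopsAt u x n` says that `n ≥ 1` and `T_n(u, x_1, …, x_n) = 1`. The input sequence
`x_1, x_2, …` is indexed from zero: `x_k` is `x (k - 1)`. -/
def StopsAt (A : XAlgorithm X) (u : Ioo (0 : ℝ) 1) (x : ℕ → X) (n : ℕ) : Prop :=
  1 ≤ n ∧ A.T n (u, fun i => x i) = true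

open Classical in
/-- The output `φ_τ(u, x_1, …, x_τ)`, with `τ = inf {n ≥ 1 : T_n(u, x_1, …, x_n) = 1}`;
it is `∞` if the algorithm does not terminate. -/
noncomputable def output (A : XAlgorithm X) (u : Ioo (0 : ℝ) 1) (x : ℕ → X) : ℝ≥0∞ :=
  if h : ∃ n, A.StopsAt u x n then
    (A.φ (Nat.find h) (u, fun i => x i) : ℝ≥0∞)
  else ∞

/-- `A` is an `f`-factory: for every probability distribution `π` on `X` with a finite first
moment, when `U` is uniform on `(0,1)` and independent of an i.i.d. sequence of law `π`
(so that their joint law is the product measure below), the `[0,∞]`-valued output of `A` has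
expectation `f (m₁(π))`. Only the values of `f` at such means, which lie in the convex hull
of `X`, matter. -/
def IsFactory (A : XAlgorithm X) (f : ℝ → ℝ≥0) : Prop :=
  ∀ (π : Measure X) [IsProbabilityMeasure π], Integrable (fun x : X => (x : ℝ)) π →
    ∫⁻ w : Ioo (0 : ℝ) 1 × (ℕ → X), A.output w.1 w.2
        ∂(uniformUnit.prod (Measure.infinitePi fun _ : ℕ => π))
      = (f (∫ x : X, (x : ℝ) ∂π) : ℝ≥0∞)

end XAlgorithm

/-! Sufficiency: after rescaling to `[0,1]`, it is enough to write `F = ∑ c i j * t ^ i * (1 - t) ^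
j` with nonnegative coefficients. Drawing `(i, j)` at random and multiplying values `t` or `1 - t`
of independent inputs then estimates `F` without bias, whatever the law. The expansion
(`isMonomialSeries_of_le`) rests on the lower bound: for a suitable monomial `w = t ^ i * (1 - t) ^
j` the quotient `v = w / F` is continuous, and `F = w / v` is a telescoping sum of terms `w * H`
with `H` continuous and positive. Each `H` is in turn a series of Bernstein polynomials with
nonnegative coefficients.

Necessity: feed the factory two-point laws on `{a, b}`. An expectation that is neither `0` nor `∞`
forces a positive mean payment on some finite history of length `n`. At mean `x` this history has
probability at least `(min (x - a) (b - x) / (b - a)) ^ n`, and since outputs are nonnegative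
nothing can cancel its contribution. -/

open unitInterval in
/-- `g` is a series, with nonnegative coefficients, of the monomials `t ^ i * (1 - t) ^ j`. -/
def IsMonomialSeries (g : I → ℝ≥0∞) : Prop :=
  ∃ c : ℕ × ℕ → ℝ≥0∞, ∀ t : I,
    g t = ∑' p, c p * ENNReal.ofReal ((t : ℝ) ^ p.1 * (1 - (t : ℝ)) ^ p.2)

namespace IsMonomialSeries

open unitInterval

theorem monomial (c : ℝ≥0∞) (i j : ℕ) :
    IsMonomialSeries fun t : I => c * ENNReal.ofReal ((t : ℝ) ^ i * (1 - (t : ℝ)) ^ j) := by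
  refine ⟨Pi.single (i, j) c, fun t => ?_⟩
  rw [tsum_eq_single (i, j)]
  · simp
  · intro p hp
    simp [Pi.single_eq_of_ne hp]

theorem tsum {ι : Type*} {g : ι → I → ℝ≥0∞} (hg : ∀ k, IsMonomialSeries (g k)) :
    IsMonomialSeries fun t => ∑' k, g k t := by
  choose c hc using hg
  refine ⟨fun p => ∑' k, c k p, fun t => ?_⟩
  simp_rw [hc, ← ENNReal.tsum_mul_right]
  exact ENNReal.tsum_comm

theorem sum {ι : Type*} [Fintype ι] {g : ι → I → ℝ≥0∞} (hg : ∀ k, IsMonomialSeries (g k)) :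
    IsMonomialSeries fun t => ∑ k, g k t := by
  simpa only [tsum_fintype] using IsMonomialSeries.tsum hg

end IsMonomialSeries

/-! ### Nonnegative monomial expansions on the unit interval. -/

section Analysis

open unitInterval

theorem isMonomialSeries_monomial_mul_bernsteinApproximation (i j m : ℕ) (P : C(I, ℝ))
    (hP : ∀ t, 0 ≤ P t) :
    IsMonomialSeries fun t : I =>
      ENNReal.ofReal ((t : ℝ) ^ i * (1 - (t : ℝ)) ^ j * bernsteinApproximation m P t) := by
  have key : ∀ t : I,
      ENNReal.ofReal ((t : ℝ) ^ i * (1 - (t : ℝ)) ^ j * bernsteinApproximation m P t) =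
        ∑ k : Fin (m + 1), ENNReal.ofReal (m.choose k * P (bernstein.z k)) *
          ENNReal.ofReal ((t : ℝ) ^ (k + i) * (1 - (t : ℝ)) ^ (m - k + j)) := by
    intro t
    have h0 : (0 : ℝ) ≤ t := t.2.1
    have h1 : (0 : ℝ) ≤ 1 - t := sub_nonneg.2 t.2.2
    have hc : ∀ k : Fin (m + 1), 0 ≤ (m.choose k * P (bernstein.z k) : ℝ) := fun k =>
      mul_nonneg (Nat.cast_nonneg _) (hP _)
    rw [bernsteinApproximation.apply, Finset.mul_sum,
      ENNReal.ofReal_sum_of_nonneg fun k _ => ?_]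
    · refine Finset.sum_congr rfl fun k _ => ?_
      rw [← ENNReal.ofReal_mul (hc k), bernstein_apply, smul_eq_mul]
      congr 1
      ring
    · rw [smul_eq_mul]
      have := hP (bernstein.z k)
      have := bernstein_nonneg (n := m) (ν := k) (x := t)
      positivity
  simp_rw [key]
  exact IsMonomialSeries.sum fun k => IsMonomialSeries.monomial _ _ _

/-- Aiming at `G / 2` with error below `min G / 4` leaves a remainder that is still positive and
smaller than `G` by a fixed factor, so the extraction can be repeated. -/
theorem exists_bernsteinApproximation_between (G : C(I, ℝ)) (hG : ∀ t, 0 < G t) :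
    ∃ (P : C(I, ℝ)) (m : ℕ), (∀ t, 0 ≤ P t) ∧
      ∀ t, 0 < G t - bernsteinApproximation m P t ∧
        G t - bernsteinApproximation m P t ≤ 3 / 4 * G t := by
  obtain ⟨t₀, -, ht₀⟩ := isCompact_univ.exists_isMinOn (univ_nonempty (α := I))
    G.continuous.continuousOn
  have hmin : ∀ t, G t₀ ≤ G t := fun t => ht₀ (mem_univ t)
  set P : C(I, ℝ) := (1 / 2 : ℝ) • G with hPdef
  have hP : ∀ t, P t = 1 / 2 * G t := fun t => rfl
  have hlim := bernsteinApproximation_uniform P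
  obtain ⟨m, hm⟩ := ((Metric.tendsto_nhds.1 hlim) (G t₀ / 4) (by have := hG t₀; positivity)).exists
  refine ⟨P, m, fun t => by rw [hP]; have := hG t; positivity, fun t => ?_⟩
  have h := (ContinuousMap.dist_apply_le_dist (f := bernsteinApproximation m P) (g := P) t).trans_lt
    hm
  rw [Real.dist_eq, hP, abs_lt] at h
  have := hmin t
  have := hG t
  constructor <;> linarith

/-- Bernstein polynomials are peeled off `G` again and again; the remainders decay like `(3 / 4) ^
k`. -/
theorem isMonomialSeries_monomial_mul (i j : ℕ) (G : C(I, ℝ)) (hG : ∀ t, 0 < G t) :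
    IsMonomialSeries fun t : I => ENNReal.ofReal ((t : ℝ) ^ i * (1 - (t : ℝ)) ^ j * G t) := by
  have step : ∀ H : {H : C(I, ℝ) // ∀ t, 0 < H t}, ∃ (P : C(I, ℝ)) (m : ℕ), (∀ t, 0 ≤ P t) ∧
      ∀ t, 0 < H.1 t - bernsteinApproximation m P t ∧
        H.1 t - bernsteinApproximation m P t ≤ 3 / 4 * H.1 t :=
    fun H => exists_bernsteinApproximation_between H.1 H.2
  choose P m hP hPm using step
  let next : {H : C(I, ℝ) // ∀ t, 0 < H t} → {H : C(I, ℝ) // ∀ t, 0 < H t} := fun H =>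
    ⟨H.1 - bernsteinApproximation (m H) (P H), fun t => (hPm H t).1⟩
  let R : ℕ → {H : C(I, ℝ) // ∀ t, 0 < H t} := fun k => next^[k] ⟨G, hG⟩
  let B : ℕ → C(I, ℝ) := fun k => bernsteinApproximation (m (R k)) (P (R k))
  have hR : ∀ k, R (k + 1) = next (R k) := fun k => Function.iterate_succ_apply' _ _ _
  have hRs : ∀ k t, (R (k + 1)).1 t = (R k).1 t - B k t := fun k t => by rw [hR]; rfl
  have hRle : ∀ k t, (R k).1 t ≤ (3 / 4) ^ k * G t := by
    intro k t
    induction k with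
    | zero => simp [R]
    | succ k ih =>
      have := (hPm (R k) t).2
      rw [hRs, pow_succ]
      change (R k).1 t - B k t ≤ _ at this
      linarith
  have hBnonneg : ∀ k t, 0 ≤ B k t := fun k t => by
    simp only [B, bernsteinApproximation.apply]
    exact Finset.sum_nonneg fun l _ => mul_nonneg bernstein_nonneg (hP _ _)
  have hpart : ∀ N t, ∑ k ∈ Finset.range N, B k t = G t - (R N).1 t := by
    intro N t
    induction N with
    | zero => simp [R]
    | succ N ih => rw [Finset.sum_range_succ, ih, hRs]; ring
  have hsum : ∀ t, HasSum (fun k => B k t) (G t) := by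
    intro t
    rw [hasSum_iff_tendsto_nat_of_nonneg (fun k => hBnonneg k t)]
    simp_rw [hpart]
    have h0 : Filter.Tendsto (fun N => (R N).1 t) Filter.atTop (nhds 0) := by
      refine squeeze_zero (fun N => ((R N).2 t).le) (fun N => hRle N t) ?_
      simpa using (tendsto_pow_atTop_nhds_zero_of_lt_one (r := (3 / 4 : ℝ)) (by norm_num)
        (by norm_num)).mul_const (G t)
    simpa using h0.const_sub (G t)
  have key : ∀ t : I, ENNReal.ofReal ((t : ℝ) ^ i * (1 - (t : ℝ)) ^ j * G t) =
      ∑' k, ENNReal.ofReal ((t : ℝ) ^ i * (1 - (t : ℝ)) ^ j * B k t) := by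
    intro t
    have h0 : (0 : ℝ) ≤ t := t.2.1
    have h1 : (0 : ℝ) ≤ 1 - t := sub_nonneg.2 t.2.2
    have h := (hsum t).mul_left ((t : ℝ) ^ i * (1 - (t : ℝ)) ^ j)
    rw [← h.tsum_eq]
    refine ENNReal.ofReal_tsum_of_nonneg (fun k => ?_) h.summable
    have := hBnonneg k t
    positivity
  simp_rw [key]
  exact IsMonomialSeries.tsum fun k =>
    isMonomialSeries_monomial_mul_bernsteinApproximation i j _ _ (hP _)

/-- With `w = v * F`, the functions `N * w / (N * v + 1)` increase to `F`, and their increments are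
`w` times a positive continuous function. Where `v` vanishes all of them are `0`, hence `hzero`. -/
theorem isMonomialSeries_of_div_continuous (i j : ℕ) (F : I → ℝ) (v : C(I, ℝ))
    (hv : ∀ t, 0 ≤ v t) (hvF : ∀ t : I, v t * F t = (t : ℝ) ^ i * (1 - (t : ℝ)) ^ j)
    (hzero : ∀ t, v t = 0 → F t = 0) :
    IsMonomialSeries fun t => ENNReal.ofReal (F t) := by
  have hden : ∀ (M : ℕ) (t : I), 0 < M * v t + 1 := fun M t => by
    have := hv t
    positivity
  let H : ℕ → C(I, ℝ) := fun M =>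
    ⟨fun t => ((M * v t + 1) * ((M + 1 : ℕ) * v t + 1))⁻¹,
      ((by fun_prop : Continuous fun t => (M * v t + 1) * ((M + 1 : ℕ) * v t + 1))).inv₀
        fun t => (mul_pos (hden _ _) (hden _ _)).ne'⟩
  have hH : ∀ M t, H M t = ((M * v t + 1) * ((M + 1 : ℕ) * v t + 1))⁻¹ := fun _ _ => rfl
  have hHpos : ∀ M t, 0 < H M t := fun M t => inv_pos.2 (mul_pos (hden _ _) (hden _ _))
  have hpart : ∀ N t, ∑ M ∈ Finset.range N, H M t = N / (N * v t + 1) := by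
    intro N t
    induction N with
    | zero => simp
    | succ N ih =>
      have h1 := (hden N t).ne'
      have h2 := (hden (N + 1) t).ne'
      rw [Finset.sum_range_succ, ih, hH]
      rw [inv_eq_one_div, div_add_div _ _ h1 (mul_ne_zero h1 h2),
        div_eq_div_iff (mul_ne_zero h1 (mul_ne_zero h1 h2)) h2]
      push_cast
      ring
  have key : ∀ t : I, ENNReal.ofReal (F t) =
      ∑' M, ENNReal.ofReal ((t : ℝ) ^ i * (1 - (t : ℝ)) ^ j * H M t) := by
    intro t
    have h0 : (0 : ℝ) ≤ t := t.2.1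
    have h1 : (0 : ℝ) ≤ 1 - t := sub_nonneg.2 t.2.2
    have hnn : ∀ M, 0 ≤ (t : ℝ) ^ i * (1 - (t : ℝ)) ^ j * H M t := fun M => by
      have := hHpos M t
      positivity
    have h : HasSum (fun M => (t : ℝ) ^ i * (1 - (t : ℝ)) ^ j * H M t) (F t) := by
      rw [hasSum_iff_tendsto_nat_of_nonneg hnn]
      simp_rw [← Finset.mul_sum, hpart, ← hvF]
      rcases (hv t).eq_or_lt with hvt | hvt
      · simp [← hvt, hzero t hvt.symm]
      · have hlim : Filter.Tendsto (fun N : ℕ => (1 / ((N : ℝ) * v t + 1))) Filter.atTop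
            (nhds 0) := by
          refine Filter.Tendsto.const_div_atTop ?_ _
          exact Filter.tendsto_atTop_add_const_right _ _
            (tendsto_natCast_atTop_atTop.atTop_mul_const hvt)
        have := (hlim.const_sub 1).mul_const (F t)
        rw [sub_zero, one_mul] at this
        refine this.congr fun N => ?_
        have := (hden N t).ne'
        field_simp
        ring
    rw [← h.tsum_eq]
    exact ENNReal.ofReal_tsum_of_nonneg hnn h.summable
  simp_rw [key]
  exact IsMonomialSeries.tsum fun M => isMonomialSeries_monomial_mul i j _ (hHpos M)

/-- One power of `s` more than in the lower bound on `F` gives `w / F ≤ s / ε`, which tends to `0`,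
the default value of the quotient at `z`. -/
theorem continuousAt_div_of_le {α : Type*} [TopologicalSpace α] {w F s : α → ℝ} {ε : ℝ} {n : ℕ}
    {z : α} (hε : 0 < ε) (hs : Continuous s) (hF : ∀ t, 0 ≤ F t) (hs0 : ∀ t, 0 ≤ s t)
    (hsz : s z = 0) (hFz : F z = 0) (hw : ∀ t, 0 ≤ w t ∧ w t ≤ s t * s t ^ n)
    (hle : ∀ᶠ t in nhds z, ε * s t ^ n ≤ F t) : ContinuousAt (fun t => w t / F t) z := by
  have hlim : Filter.Tendsto (fun t => s t / ε) (nhds z) (nhds 0) := by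
    simpa [hsz] using (hs.tendsto z).div_const ε
  rw [ContinuousAt, hFz, div_zero]
  refine squeeze_zero' (Filter.Eventually.of_forall fun t => div_nonneg (hw t).1 (hF t)) ?_ hlim
  filter_upwards [hle] with t ht
  refine div_le_of_le_mul₀ (hF t) (div_nonneg (hs0 t) hε.le) ((hw t).2.trans ?_)
  rw [div_mul_eq_mul_div, le_div_iff₀ hε, mul_assoc]
  exact mul_le_mul_of_nonneg_left (by rwa [mul_comm]) (hs0 t)

theorem isMonomialSeries_of_le (F : C(I, ℝ)) (hF : ∀ t, 0 ≤ F t) (ε : ℝ) (hε : 0 < ε) (n : ℕ)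
    (h : ∀ t : I, ε * min ((t : ℝ) ^ n) ((1 - (t : ℝ)) ^ n) ≤ F t) :
    IsMonomialSeries fun t => ENNReal.ofReal (F t) := by
  classical
  -- The monomial must vanish at exactly the endpoints where `F` does: elsewhere `v` would have a
  -- zero at which `F` is nonzero.
  obtain ⟨i, hi0, hi1⟩ : ∃ i : ℕ, (F 0 = 0 → i = n + 1) ∧ (F 0 ≠ 0 → i = 0) :=
    ⟨if F 0 = 0 then n + 1 else 0, fun h => if_pos h, fun h => if_neg h⟩
  obtain ⟨j, hj0, hj1⟩ : ∃ j : ℕ, (F 1 = 0 → j = n + 1) ∧ (F 1 ≠ 0 → j = 0) :=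
    ⟨if F 1 = 0 then n + 1 else 0, fun h => if_pos h, fun h => if_neg h⟩
  have hend : ∀ t : I, F t = 0 → t = 0 ∨ t = 1 := by
    intro t ht
    by_contra! hne
    have h0 : (0 : ℝ) < t := unitInterval.pos_iff_ne_zero.2 hne.1
    have h1 : (0 : ℝ) < 1 - t := sub_pos.2 (unitInterval.lt_one_iff_ne_one.2 hne.2)
    have : 0 < ε * min ((t : ℝ) ^ n) ((1 - (t : ℝ)) ^ n) := by positivity
    linarith [h t]
  have hwF : ∀ t : I, F t = 0 → (t : ℝ) ^ i * (1 - (t : ℝ)) ^ j = 0 := by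
    intro t ht
    rcases hend t ht with rfl | rfl
    · simp [hi0 ht]
    · simp [hj0 ht]
  have hFw : ∀ t : I, (t : ℝ) ^ i * (1 - (t : ℝ)) ^ j = 0 → F t = 0 := by
    intro t ht
    rcases mul_eq_zero.1 ht with ht | ht <;> obtain ⟨ht, hne⟩ := pow_eq_zero_iff'.1 ht
    · rw [show t = 0 from Subtype.ext ht]
      exact not_imp_comm.1 hi1 hne
    · rw [show t = 1 from Subtype.ext (sub_eq_zero.1 ht).symm]
      exact not_imp_comm.1 hj1 hne
  have hcont : Continuous fun t : I => (t : ℝ) ^ i * (1 - (t : ℝ)) ^ j / F t := by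
    refine continuous_iff_continuousAt.2 fun z => ?_
    by_cases hz : F z = 0
    · rcases hend z hz with rfl | rfl
      · refine continuousAt_div_of_le hε (by fun_prop : Continuous fun t : I => (t : ℝ)) hF
          (fun t => t.2.1) (by simp) hz (fun t => ?_) ?_ (n := n)
        · have h1 : (0 : ℝ) ≤ 1 - t := sub_nonneg.2 t.2.2
          have h0 : (0 : ℝ) ≤ t := t.2.1
          rw [hi0 hz, ← pow_succ']
          exact ⟨by positivity, mul_le_of_le_one_right (by positivity)
            (pow_le_one₀ h1 (by linarith))⟩
        · have : ∀ᶠ t : I in nhds 0, (t : ℝ) < 1 / 2 :=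
            (by fun_prop : Continuous fun t : I => (t : ℝ)).continuousAt.eventually_lt
              continuousAt_const (by norm_num)
          filter_upwards [this] with t ht
          have := h t
          rwa [min_eq_left (pow_le_pow_left₀ t.2.1 (by linarith) n)] at this
      · refine continuousAt_div_of_le hε (by fun_prop : Continuous fun t : I => 1 - (t : ℝ)) hF
          (fun t => sub_nonneg.2 t.2.2) (by simp) hz (fun t => ?_) ?_ (n := n)
        · have h1 : (0 : ℝ) ≤ 1 - t := sub_nonneg.2 t.2.2
          have h0 : (0 : ℝ) ≤ t := t.2.1
          rw [hj0 hz, ← pow_succ']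
          exact ⟨by positivity, mul_le_of_le_one_left (by positivity)
            (pow_le_one₀ h0 t.2.2)⟩
        · have : ∀ᶠ t : I in nhds 1, 1 / 2 < (t : ℝ) :=
            continuousAt_const.eventually_lt
              (by fun_prop : Continuous fun t : I => (t : ℝ)).continuousAt (by norm_num)
          filter_upwards [this] with t ht
          have := h t
          rwa [min_eq_right (pow_le_pow_left₀ (sub_nonneg.2 t.2.2) (by linarith) n)] at this
    · exact ContinuousAt.div (by fun_prop) (by fun_prop) hz
  refine isMonomialSeries_of_div_continuous i j F ⟨_, hcont⟩ (fun t => ?_) (fun t => ?_)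
    fun t ht => ?_
  · have h1 : (0 : ℝ) ≤ 1 - t := sub_nonneg.2 t.2.2
    have h0 : (0 : ℝ) ≤ t := t.2.1
    have := hF t
    simp only [ContinuousMap.coe_mk]
    positivity
  · exact div_mul_cancel_of_imp (hwF t)
  · rcases div_eq_zero_iff.1 ht with ht | ht
    · exact hFw t ht
    · exact ht

end Analysis

/-! ### Sampling an index from one uniform variable. -/

section Randomization

instance isProbabilityMeasure_uniformUnit : IsProbabilityMeasure uniformUnit := by
  refine ⟨?_⟩
  rw [uniformUnit, comap_subtype_coe_apply measurableSet_Ioo, image_univ,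
    Subtype.range_coe, Real.volume_Ioo]
  simp

/-- One uniform variable suffices to sample an index that charges every point of a given
nonempty countable type. -/
theorem exists_measurable_uniformUnit_preimage_ne_zero (ι : Type*) [Countable ι] [Nonempty ι]
    [MeasurableSpace ι] :
    ∃ K : Ioo (0 : ℝ) 1 → ι, Measurable K ∧ ∀ k, uniformUnit (K ⁻¹' {k}) ≠ 0 := by
  obtain ⟨e, he⟩ := exists_surjective_nat ι
  -- The floor equals `m + 1` on the interval from `1 / (m + 2)` to `1 / (m + 1)`, which has
  -- positive length.
  refine ⟨fun u => e (⌊(u : ℝ)⁻¹⌋₊ - 1), ?_, fun k => ?_⟩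
  · exact (measurable_from_nat (f := fun m => e (m - 1))).comp
      (Nat.measurable_floor.comp measurable_subtype_coe.inv)
  · obtain ⟨m, rfl⟩ := he k
    have hm : (0 : ℝ) < m + 1 := by positivity
    have hlt : ((m : ℝ) + 2)⁻¹ < ((m : ℝ) + 1)⁻¹ := inv_strictAnti₀ hm (by linarith)
    have hpos : uniformUnit (Subtype.val ⁻¹' Ioo ((m : ℝ) + 2)⁻¹ ((m : ℝ) + 1)⁻¹) ≠ 0 := by
      have hsub : Ioo ((m : ℝ) + 2)⁻¹ ((m : ℝ) + 1)⁻¹ ⊆ Ioo 0 1 :=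
        Ioo_subset_Ioo (by positivity) (inv_le_one_of_one_le₀ (by simp))
      rw [uniformUnit, comap_subtype_coe_apply measurableSet_Ioo, Subtype.image_preimage_coe,
        inter_eq_right.2 hsub, Real.volume_Ioo]
      simpa using hlt
    refine fun h0 => hpos (measure_mono_null (fun u hu => ?_) h0)
    have hu0 : (0 : ℝ) < u := u.2.1
    have h1 : (m : ℝ) + 1 < (u : ℝ)⁻¹ := (lt_inv_comm₀ hm hu0).2 hu.2
    have h2 : (u : ℝ)⁻¹ < m + 2 := (inv_lt_comm₀ (by positivity) hu0).1 hu.1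
    have hfloor : ⌊(u : ℝ)⁻¹⌋₊ = m + 1 := by
      rw [Nat.floor_eq_iff (by positivity)]
      push_cast
      exact ⟨h1.le, by linarith⟩
    simp [hfloor]

end Randomization

/-! ### Expectations of products over independent inputs. -/

section IIDProducts

theorem lintegral_infinitePi_prod_range {X : Type*} [MeasurableSpace X] (π : Measure X)
    [IsProbabilityMeasure π] (n : ℕ) (g : ℕ → X → ℝ≥0∞) (hg : ∀ l, Measurable (g l)) :
    ∫⁻ x, ∏ l ∈ Finset.range n, g l (x l) ∂(Measure.infinitePi fun _ : ℕ => π) =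
      ∏ l ∈ Finset.range n, ∫⁻ x, g l x ∂π := by
  rw [ProbabilityTheory.lintegral_prod_eq_prod_lintegral_of_indepFun (Finset.range n)
    (fun l (x : ℕ → X) => g l (x l))
    (ProbabilityTheory.iIndepFun_infinitePi (P := fun _ : ℕ => π) (X := g) hg)
    fun l => (hg l).comp (measurable_pi_apply l)]
  refine Finset.prod_congr rfl fun l _ => ?_
  rw [← lintegral_map (hg l) (measurable_pi_apply l), Measure.infinitePi_map_eval]

theorem prod_range_ite_ite {M : Type*} [CommMonoid M] (i j : ℕ) (A B : M) :
    ∏ l ∈ Finset.range (i + j + 1), (if l < i then A else if l < i + j then B else 1) =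
      A ^ i * B ^ j := by
  rw [Finset.prod_range_succ, Finset.prod_range_add]
  have h1 : ∏ l ∈ Finset.range i, (if l < i then A else if l < i + j then B else 1) = A ^ i := by
    rw [Finset.prod_congr rfl fun l hl => if_pos (Finset.mem_range.1 hl)]
    simp
  have h2 : ∏ l ∈ Finset.range j, (if i + l < i then A else if i + l < i + j then B else 1) =
      B ^ j := by
    rw [Finset.prod_congr rfl fun l hl => by
      rw [if_neg (by omega), if_pos (by have := Finset.mem_range.1 hl; omega)]]
    simp
  rw [h1, h2]
  simp

end IIDProducts

/-! ### The factory built from a monomial series. -/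

namespace XAlgorithm

theorem output_eq_of_first {X : Set ℝ} (A : XAlgorithm X) (u : Ioo (0 : ℝ) 1) (x : ℕ → X) (n : ℕ)
    (hn : A.StopsAt u x n) (hmin : ∀ m < n, ¬ A.StopsAt u x m) :
    A.output u x = A.φ n (u, fun i => x i) := by
  classical
  have h : ∃ n, A.StopsAt u x n := ⟨n, hn⟩
  obtain rfl : n = Nat.find h := ((Nat.find_eq_iff h).2 ⟨hn, hmin⟩).symm
  rw [output, dif_pos h]

/-- The relative position of a point of `[a, b]`. -/
noncomputable def position (a b : ℝ) (x : Icc a b) : ℝ := ((x : ℝ) - a) / (b - a)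

theorem position_mem_unitInterval {a b : ℝ} (x : Icc a b) : position a b x ∈ Icc (0 : ℝ) 1 :=
  ⟨div_nonneg (sub_nonneg.2 x.2.1) (sub_nonneg.2 (x.2.1.trans x.2.2)),
    div_le_one_of_le₀ (sub_le_sub_right x.2.2 a) (sub_nonneg.2 (x.2.1.trans x.2.2))⟩

theorem measurable_position (a b : ℝ) : Measurable (position a b) := by
  unfold position
  fun_prop

/-- The contribution of the `l`-th input to an unbiased estimator of `t ^ i * (1 - t) ^ j`. -/
noncomputable def factor (a b : ℝ) (p : ℕ × ℕ) (l : ℕ) (x : Icc a b) : ℝ≥0 :=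
  if l < p.1 then (position a b x).toNNReal
  else if l < p.1 + p.2 then (1 - position a b x).toNNReal else 1

theorem measurable_factor (a b : ℝ) (p : ℕ × ℕ) (l : ℕ) : Measurable (factor a b p l) := by
  have := measurable_position a b
  unfold factor
  split_ifs <;> fun_prop

/-- Sample a pair `(i, j)`, read `i + j + 1` inputs, and return a rescaled unbiased estimator
of `t ^ i * (1 - t) ^ j`. -/
noncomputable def monomialSampler (a b : ℝ) (K : Ioo (0 : ℝ) 1 → ℕ × ℕ) (hK : Measurable K)
    (d : ℕ × ℕ → ℝ≥0) : XAlgorithm (Icc a b) where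
  -- The additional input, whose factor is `1`, keeps the stopping time at least `1` when `i = j =
  -- 0`.
  T n w := decide (n = (K w.1).1 + (K w.1).2 + 1)
  φ n w := d (K w.1) * ∏ l : Fin n, factor a b (K w.1) l (w.2 l)
  measurable_T n := (measurable_of_countable fun p : ℕ × ℕ => decide (n = p.1 + p.2 + 1)).comp
    (hK.comp measurable_fst)
  measurable_φ n := by
    have h : Measurable fun z : (Fin n → Icc a b) × (ℕ × ℕ) =>
        d z.2 * ∏ l : Fin n, factor a b z.2 l (z.1 l) := by
      refine measurable_from_prod_countable_left fun p => ?_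
      dsimp only
      refine Measurable.const_mul ?_ _
      refine Finset.measurable_fun_prod _ fun l _ => ?_
      exact (measurable_factor a b p l).comp (measurable_pi_apply l)
    exact h.comp (measurable_snd.prodMk (hK.comp measurable_fst))

theorem output_monomialSampler (a b : ℝ) (K : Ioo (0 : ℝ) 1 → ℕ × ℕ) (hK : Measurable K)
    (d : ℕ × ℕ → ℝ≥0) (u : Ioo (0 : ℝ) 1) (x : ℕ → Icc a b) :
    (monomialSampler a b K hK d).output u x = d (K u) *
      ∏ l ∈ Finset.range ((K u).1 + (K u).2 + 1), (factor a b (K u) l (x l) : ℝ≥0∞) := by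
  rw [output_eq_of_first _ u x ((K u).1 + (K u).2 + 1)]
  · simp only [monomialSampler, ENNReal.coe_mul, ENNReal.ofNNReal_finsetProd]
    rw [Finset.prod_range]
  · simp [StopsAt, monomialSampler]
  · intro m hm
    simp [StopsAt, monomialSampler, hm.ne]

theorem lintegral_prod_factor (a b : ℝ) (π : Measure (Icc a b)) [IsProbabilityMeasure π]
    (hπ : Integrable (fun x : Icc a b => (x : ℝ)) π) (p : ℕ × ℕ) :
    ∫⁻ x, ∏ l ∈ Finset.range (p.1 + p.2 + 1), (factor a b p l (x l) : ℝ≥0∞)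
        ∂(Measure.infinitePi fun _ : ℕ => π) =
      ENNReal.ofReal ((((∫ x, (x : ℝ) ∂π) - a) / (b - a)) ^ p.1 *
        (1 - ((∫ x, (x : ℝ) ∂π) - a) / (b - a)) ^ p.2) := by
  have hint : Integrable (position a b) π := (hπ.sub (integrable_const a)).div_const _
  have hmean : ∫ x, position a b x ∂π = ((∫ x, (x : ℝ) ∂π) - a) / (b - a) := by
    simp only [position]
    rw [integral_div, integral_sub hπ (integrable_const a)]
    simp
  have hpos : ∫⁻ x, ((position a b x).toNNReal : ℝ≥0∞) ∂π =
      ENNReal.ofReal (((∫ x, (x : ℝ) ∂π) - a) / (b - a)) := by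
    rw [← hmean, ofReal_integral_eq_lintegral_ofReal hint
      (ae_of_all _ fun x => (position_mem_unitInterval x).1)]
    rfl
  have hneg : ∫⁻ x, ((1 - position a b x).toNNReal : ℝ≥0∞) ∂π =
      ENNReal.ofReal (1 - ((∫ x, (x : ℝ) ∂π) - a) / (b - a)) := by
    have : 1 - ((∫ x, (x : ℝ) ∂π) - a) / (b - a) = ∫ x, (1 - position a b x) ∂π := by
      rw [integral_sub (integrable_const _) hint, hmean]
      simp
    rw [this, ofReal_integral_eq_lintegral_ofReal (f := fun x => 1 - position a b x)
      ((integrable_const _).sub hint)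
      (ae_of_all _ fun x => sub_nonneg.2 (position_mem_unitInterval x).2)]
    rfl
  have h0 : 0 ≤ ((∫ x, (x : ℝ) ∂π) - a) / (b - a) := by
    rw [← hmean]
    exact integral_nonneg fun x => (position_mem_unitInterval x).1
  rw [lintegral_infinitePi_prod_range π _ (fun l x => (factor a b p l x : ℝ≥0∞))
    fun l => (measurable_factor a b p l).coe_nnreal_ennreal,
    ENNReal.ofReal_mul (pow_nonneg h0 _), ENNReal.ofReal_pow h0, ENNReal.ofReal_pow, ← hpos,
    ← hneg, ← prod_range_ite_ite]
  · refine Finset.prod_congr rfl fun l _ => ?_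
    unfold factor
    split_ifs <;> simp
  · rw [← hmean, sub_nonneg]
    calc ∫ x, position a b x ∂π ≤ ∫ _, (1 : ℝ) ∂π :=
          integral_mono hint (integrable_const _) fun x => (position_mem_unitInterval x).2
      _ = 1 := by simp

/-- Importance weighting: paying `c p / q p` cancels the probability `q p` of drawing `p`, so only
`q p ≠ 0` matters. -/
theorem exists_isFactory_of_monomialSeries (a b : ℝ) (f : ℝ → ℝ≥0) (c : ℕ × ℕ → ℝ≥0)
    (h : ∀ x ∈ Icc a b, (f x : ℝ≥0∞) = ∑' p, c p *
      ENNReal.ofReal (((x - a) / (b - a)) ^ p.1 * (1 - (x - a) / (b - a)) ^ p.2)) :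
    ∃ A : XAlgorithm (Icc a b), A.IsFactory f := by
  obtain ⟨K, hK, hq⟩ := exists_measurable_uniformUnit_preimage_ne_zero (ℕ × ℕ)
  let q : ℕ × ℕ → ℝ≥0 := fun p => (uniformUnit (K ⁻¹' {p})).toNNReal
  have hqc : ∀ p, (q p : ℝ≥0∞) = uniformUnit (K ⁻¹' {p}) := fun p =>
    ENNReal.coe_toNNReal (measure_ne_top _ _)
  have hq0 : ∀ p, q p ≠ 0 := fun p h0 => hq p (by rw [← hqc, h0, ENNReal.coe_zero])
  refine ⟨monomialSampler a b K hK fun p => c p / q p, fun π _ hπ => ?_⟩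
  simp_rw [output_monomialSampler]
  set d : ℕ × ℕ → ℝ≥0 := fun p => c p / q p
  have hmeas : Measurable fun w : Ioo (0 : ℝ) 1 × (ℕ → Icc a b) => (d (K w.1) : ℝ≥0∞) *
      ∏ l ∈ Finset.range ((K w.1).1 + (K w.1).2 + 1), (factor a b (K w.1) l (w.2 l) : ℝ≥0∞) := by
    have h : Measurable fun z : (ℕ → Icc a b) × (ℕ × ℕ) => (d z.2 : ℝ≥0∞) *
        ∏ l ∈ Finset.range (z.2.1 + z.2.2 + 1), (factor a b z.2 l (z.1 l) : ℝ≥0∞) := by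
      refine measurable_from_prod_countable_left fun p => ?_
      dsimp only
      refine Measurable.const_mul ?_ _
      refine Finset.measurable_fun_prod _ fun l _ => ?_
      exact ((measurable_factor a b p l).comp (measurable_pi_apply l)).coe_nnreal_ennreal
    exact h.comp (measurable_snd.prodMk (hK.comp measurable_fst))
  rw [lintegral_prod _ hmeas.aemeasurable]
  have hmem : ∫ x : Icc a b, (x : ℝ) ∂π ∈ Icc a b := by
    constructor
    · calc a = ∫ _ : Icc a b, a ∂π := by simp
        _ ≤ _ := integral_mono (integrable_const a) hπ fun x => x.2.1
    · calc _ ≤ ∫ _ : Icc a b, b ∂π := integral_mono hπ (integrable_const b) fun x => x.2.2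
        _ = b := by simp
  set m := ∫ x : Icc a b, (x : ℝ) ∂π
  set g : ℕ × ℕ → ℝ≥0∞ := fun p => (d p : ℝ≥0∞) *
    ENNReal.ofReal (((m - a) / (b - a)) ^ p.1 * (1 - (m - a) / (b - a)) ^ p.2)
  have hinner : ∀ u, ∫⁻ x, (d (K u) : ℝ≥0∞) * ∏ l ∈ Finset.range ((K u).1 + (K u).2 + 1),
      (factor a b (K u) l (x l) : ℝ≥0∞) ∂(Measure.infinitePi fun _ : ℕ => π) =
      g (K u) := by
    intro u
    rw [lintegral_const_mul' _ _ ENNReal.coe_ne_top, lintegral_prod_factor a b π hπ]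
  simp_rw [hinner]
  rw [← lintegral_map (measurable_of_countable g) hK, lintegral_countable', h m hmem]
  refine tsum_congr fun p => ?_
  rw [Measure.map_apply hK (measurableSet_singleton p), ← hqc, mul_right_comm, ← ENNReal.coe_mul,
    div_mul_cancel₀ _ (hq0 p)]

end XAlgorithm

theorem exists_isFactory_of_le (a b : ℝ) (hab : a ≤ b) (f : ℝ → ℝ≥0)
    (hf : ContinuousOn f (Icc a b)) (hf0 : ∃ x ∈ Icc a b, f x ≠ 0) (ε : ℝ) (hε : 0 < ε) (n : ℕ)
    (h : ∀ x ∈ Icc a b, ε * min ((x - a) ^ n) ((b - x) ^ n) ≤ (f x : ℝ)) :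
    ∃ A : XAlgorithm (Icc a b), A.IsFactory f := by
  have hba : 0 ≤ b - a := sub_nonneg.2 hab
  have hmem : ∀ t : unitInterval, a + (b - a) * t ∈ Icc a b := fun t =>
    ⟨by nlinarith [mul_nonneg hba t.2.1], by nlinarith [mul_le_mul_of_nonneg_left t.2.2 hba]⟩
  have hcont : Continuous fun t : unitInterval => ((f (a + (b - a) * t) : ℝ≥0) : ℝ) :=
    NNReal.continuous_coe.comp (hf.comp_continuous (by fun_prop) hmem)
  obtain ⟨δ, hδ, hle⟩ : ∃ δ : ℝ, 0 < δ ∧ ∀ t : unitInterval,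
      δ * min ((t : ℝ) ^ n) ((1 - (t : ℝ)) ^ n) ≤ f (a + (b - a) * t) := by
    rcases hab.eq_or_lt with rfl | hlt
    · obtain ⟨x, hx, hfx⟩ := hf0
      obtain rfl : x = a := by simpa using hx
      refine ⟨f x, NNReal.coe_pos.2 (pos_iff_ne_zero.2 hfx), fun t => ?_⟩
      rw [sub_self, zero_mul, add_zero]
      exact mul_le_of_le_one_right (f x).2
        ((min_le_left _ _).trans (pow_le_one₀ t.2.1 t.2.2))
    · have hpos : 0 < b - a := sub_pos.2 hlt
      refine ⟨ε * (b - a) ^ n, by positivity, fun t => ?_⟩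
      have := h _ (hmem t)
      rwa [show a + (b - a) * (t : ℝ) - a = (b - a) * t by ring,
        show b - (a + (b - a) * (t : ℝ)) = (b - a) * (1 - t) by ring, mul_pow, mul_pow,
        ← mul_min_of_nonneg _ _ (pow_nonneg hba n), ← mul_assoc] at this
  obtain ⟨c, hc⟩ := isMonomialSeries_of_le ⟨_, hcont⟩ (fun t => NNReal.coe_nonneg _) δ hδ n hle
  -- At `t = 1 / 2` every monomial is positive while the sum is finite.
  have hctop : ∀ p, c p ≠ ∞ := by
    intro p hp
    have hhalf := hc ⟨1 / 2, by norm_num, by norm_num⟩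
    have : c p * ENNReal.ofReal ((1 / 2 : ℝ) ^ p.1 * (1 - 1 / 2) ^ p.2) ≤ _ :=
      ENNReal.le_tsum (f := fun p => c p * ENNReal.ofReal ((1 / 2 : ℝ) ^ p.1 * (1 - 1 / 2) ^ p.2)) p
    rw [← hhalf, hp, ENNReal.top_mul] at this
    · exact ENNReal.ofReal_ne_top (top_le_iff.1 this)
    · rw [Ne, ENNReal.ofReal_eq_zero, not_le]
      positivity
  refine XAlgorithm.exists_isFactory_of_monomialSeries a b f (fun p => (c p).toNNReal)
    fun x hx => ?_
  have := hc ⟨XAlgorithm.position a b ⟨x, hx⟩, XAlgorithm.position_mem_unitInterval _⟩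
  simp only [ContinuousMap.coe_mk, XAlgorithm.position, ENNReal.ofReal_coe_nnreal] at this
  have hx' : a + (b - a) * ((x - a) / (b - a)) = x := by
    rcases hab.eq_or_lt with rfl | hlt
    · simpa using hx.1.antisymm hx.2
    · rw [mul_div_cancel₀ _ (sub_pos.2 hlt).ne']
      ring
  rw [hx'] at this
  rw [this]
  exact tsum_congr fun p => by rw [ENNReal.coe_toNNReal (hctop p)]

/-! ### Necessity of the lower bound, by two-point laws. -/

namespace XAlgorithm

variable {X : Set ℝ}

open Classical in
/-- The output of `A` on the event that it stops exactly at time `n`, and zero elsewhere. -/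
noncomputable def outputAt (A : XAlgorithm X) (n : ℕ) (u : Ioo (0 : ℝ) 1) (x : ℕ → X) : ℝ≥0∞ :=
  if A.StopsAt u x n ∧ ∀ m < n, ¬ A.StopsAt u x m then (A.φ n (u, fun i => x i) : ℝ≥0∞) else 0

theorem stopsAt_congr (A : XAlgorithm X) {n : ℕ} (u : Ioo (0 : ℝ) 1) {x y : ℕ → X}
    (h : ∀ k < n, x k = y k) : A.StopsAt u x n ↔ A.StopsAt u y n := by
  have : (fun i : Fin n => x i) = fun i : Fin n => y i := funext fun i => h i i.2
  rw [StopsAt, StopsAt, this]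

theorem outputAt_congr (A : XAlgorithm X) {n : ℕ} (u : Ioo (0 : ℝ) 1) {x y : ℕ → X}
    (h : ∀ k < n, x k = y k) : A.outputAt n u x = A.outputAt n u y := by
  have hxy : (fun i : Fin n => x i) = fun i : Fin n => y i := funext fun i => h i i.2
  have hlt : (∀ m < n, ¬ A.StopsAt u x m) ↔ ∀ m < n, ¬ A.StopsAt u y m :=
    forall₂_congr fun m hm => not_congr (A.stopsAt_congr u fun k hk => h k (hk.trans hm))
  unfold outputAt
  have hiff := and_congr (A.stopsAt_congr u h) hlt
  rw [hxy]
  split_ifs with h₁ h₂ h₂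
  · rfl
  · exact absurd (hiff.1 h₁) h₂
  · exact absurd (hiff.2 h₂) h₁
  · rfl

theorem outputAt_le_output (A : XAlgorithm X) (n : ℕ) (u : Ioo (0 : ℝ) 1) (x : ℕ → X) :
    A.outputAt n u x ≤ A.output u x := by
  unfold outputAt
  split_ifs with h
  · exact (A.output_eq_of_first u x n h.1 h.2).ge
  · exact zero_le

theorem output_eq_indicator (A : XAlgorithm X) (u : Ioo (0 : ℝ) 1) (x : ℕ → X)
    (h : ∀ n, A.outputAt n u x = 0) :
    A.output u x = {w : Ioo (0 : ℝ) 1 × (ℕ → X) | ∀ n, ¬ A.StopsAt w.1 w.2 n}.indicator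
      (fun _ => ∞) (u, x) := by
  classical
  by_cases hs : ∃ n, A.StopsAt u x n
  · rw [indicator_of_notMem (by simpa using hs)]
    have hmin : ∀ m < Nat.find hs, ¬ A.StopsAt u x m := fun m hm => Nat.find_min hs hm
    rw [A.output_eq_of_first u x _ (Nat.find_spec hs) hmin, ← h (Nat.find hs), outputAt,
      if_pos ⟨Nat.find_spec hs, hmin⟩]
  · rw [indicator_of_mem (by simpa using hs), output, dif_neg hs]

theorem measurableSet_stopsAt (A : XAlgorithm X) (n : ℕ) :
    MeasurableSet {w : Ioo (0 : ℝ) 1 × (ℕ → X) | A.StopsAt w.1 w.2 n} := by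
  refine MeasurableSet.inter (MeasurableSet.const _) ?_
  exact ((A.measurable_T n).comp (by fun_prop : Measurable fun w : Ioo (0 : ℝ) 1 × (ℕ → X) =>
    (w.1, fun i : Fin n => w.2 i))) (measurableSet_singleton true)

theorem measurable_outputAt (A : XAlgorithm X) (n : ℕ) :
    Measurable fun w : Ioo (0 : ℝ) 1 × (ℕ → X) => A.outputAt n w.1 w.2 := by
  have hlt : MeasurableSet {w : Ioo (0 : ℝ) 1 × (ℕ → X) | ∀ m < n, ¬ A.StopsAt w.1 w.2 m} := by
    simp only [ofPred_forall]
    exact MeasurableSet.iInter fun m => MeasurableSet.iInter fun _ =>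
      (A.measurableSet_stopsAt m).compl
  refine Measurable.ite ((A.measurableSet_stopsAt n).inter hlt) ?_ measurable_const
  exact ((A.measurable_φ n).comp (by fun_prop : Measurable fun w : Ioo (0 : ℝ) 1 × (ℕ → X) =>
      (w.1, fun i : Fin n => w.2 i))).coe_nnreal_ennreal

/-- The law charging `e₁` with mass `p` and `e₀` with mass `1 - p`. -/
noncomputable def twoPoint (e₀ e₁ : X) (p : ℝ) : Measure X :=
  ENNReal.ofReal (1 - p) • Measure.dirac e₀ + ENNReal.ofReal p • Measure.dirac e₁

theorem isProbabilityMeasure_twoPoint (e₀ e₁ : X) {p : ℝ} (hp : p ∈ Icc (0 : ℝ) 1) :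
    IsProbabilityMeasure (twoPoint e₀ e₁ p) := by
  refine ⟨?_⟩
  simp only [twoPoint, Measure.add_apply, Measure.smul_apply, measure_univ, smul_eq_mul, mul_one]
  rw [← ENNReal.ofReal_add (sub_nonneg.2 hp.2) hp.1]
  simp

theorem integrable_twoPoint (e₀ e₁ : X) (p : ℝ) :
    Integrable (fun x : X => (x : ℝ)) (twoPoint e₀ e₁ p) :=
  ((integrable_dirac (by simp)).smul_measure ENNReal.ofReal_ne_top).add_measure
    ((integrable_dirac (by simp)).smul_measure ENNReal.ofReal_ne_top)

theorem integral_twoPoint (e₀ e₁ : X) {p : ℝ} (hp : p ∈ Icc (0 : ℝ) 1) :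
    ∫ x : X, (x : ℝ) ∂(twoPoint e₀ e₁ p) = (1 - p) * e₀ + p * e₁ := by
  rw [twoPoint, integral_add_measure
    ((integrable_dirac (by simp)).smul_measure ENNReal.ofReal_ne_top)
    ((integrable_dirac (by simp)).smul_measure ENNReal.ofReal_ne_top),
    integral_smul_measure, integral_smul_measure, integral_dirac, integral_dirac,
    ENNReal.toReal_ofReal (sub_nonneg.2 hp.2), ENNReal.toReal_ofReal hp.1, smul_eq_mul,
    smul_eq_mul]

/-- The sequence equal to `e₁` at the positions in `s`, and to `e₀` elsewhere. -/
def twoValued (e₀ e₁ : X) (s : Finset ℕ) (k : ℕ) : X := if k ∈ s then e₁ else e₀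

theorem le_twoPoint_singleton (e₀ e₁ : X) {p r : ℝ} (h₀ : r ≤ 1 - p) (h₁ : r ≤ p)
    (s : Finset ℕ) (k : ℕ) :
    ENNReal.ofReal r ≤ twoPoint e₀ e₁ p {twoValued e₀ e₁ s k} := by
  unfold twoValued twoPoint
  split_ifs
  · refine (ENNReal.ofReal_le_ofReal h₁).trans ?_
    simp
  · refine (ENNReal.ofReal_le_ofReal h₀).trans ?_
    simp

theorem ae_twoPoint_mem (e₀ e₁ : X) (p : ℝ) : ∀ᵐ x ∂(twoPoint e₀ e₁ p), x = e₀ ∨ x = e₁ := by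
  rw [twoPoint, ae_add_measure_iff]
  exact ⟨Measure.ae_smul_measure (by simp [ae_dirac_eq]) _,
    Measure.ae_smul_measure (by simp [ae_dirac_eq]) _⟩

/-- There are only countably many pairs `(n, s)`. If all these integrals vanished, the output would
almost surely be `0` or `∞`, with expectation `0` or `∞`, whereas `f` is finite and nonzero at the
mean. -/
theorem IsFactory.exists_lintegral_outputAt_ne_zero {A : XAlgorithm X} {f : ℝ → ℝ≥0}
    (hA : A.IsFactory f) (e₀ e₁ : X) {p : ℝ} (hp : p ∈ Icc (0 : ℝ) 1)
    (hfp : f ((1 - p) * e₀ + p * e₁) ≠ 0) :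
    ∃ n s, ∫⁻ u, A.outputAt n u (twoValued e₀ e₁ s) ∂uniformUnit ≠ 0 := by
  classical
  by_contra! hzero
  have := isProbabilityMeasure_twoPoint e₀ e₁ hp
  set π := twoPoint e₀ e₁ p
  have hu : ∀ᵐ u ∂uniformUnit, ∀ n s, A.outputAt n u (twoValued e₀ e₁ s) = 0 := by
    refine ae_all_iff.2 fun n => ae_all_iff.2 fun s => ?_
    exact (lintegral_eq_zero_iff ((A.measurable_outputAt n).comp
      (measurable_id.prodMk measurable_const))).1 (hzero n s)
  have hx : ∀ᵐ x ∂(Measure.infinitePi fun _ : ℕ => π), ∀ k, x k = e₀ ∨ x k = e₁ :=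
    ae_all_iff.2 fun k => (measurePreserving_eval_infinitePi (fun _ : ℕ => π)
      k).quasiMeasurePreserving.ae (ae_twoPoint_mem e₀ e₁ p)
  set S := {w : Ioo (0 : ℝ) 1 × (ℕ → X) | ∀ n, ¬ A.StopsAt w.1 w.2 n}
  have hS : MeasurableSet S := by
    simp only [S, ofPred_forall]
    exact MeasurableSet.iInter fun n => (A.measurableSet_stopsAt n).compl
  have hae : ∀ᵐ w ∂(uniformUnit.prod (Measure.infinitePi fun _ : ℕ => π)),
      A.output w.1 w.2 = S.indicator (fun _ => ∞) w := by
    filter_upwards [Measure.quasiMeasurePreserving_fst.ae hu,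
      Measure.quasiMeasurePreserving_snd.ae hx] with w hw1 hw2
    refine A.output_eq_indicator w.1 w.2 fun n => ?_
    -- This finite set reproduces the first `n` inputs, all that the output at time `n` depends on.
    rw [← hw1 n ((Finset.range n).filter fun k => w.2 k = e₁)]
    refine A.outputAt_congr _ fun k hk => ?_
    rcases eq_or_ne (w.2 k) e₁ with h1 | h1
    · simp [twoValued, h1, hk]
    · simpa [twoValued, h1] using (hw2 k).resolve_right h1
  have hE := hA π (integrable_twoPoint e₀ e₁ p)
  rw [integral_twoPoint e₀ e₁ hp, lintegral_congr_ae hae, lintegral_indicator_const hS] at hE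
  rcases eq_or_ne ((uniformUnit.prod (Measure.infinitePi fun _ : ℕ => π)) S) 0 with h0 | h0
  · rw [h0, mul_zero] at hE
    exact hfp (by exact_mod_cast hE.symm)
  · rw [ENNReal.top_mul h0] at hE
    exact ENNReal.coe_ne_top hE.symm

/-- Only the cylinder of sequences that agree with the given history up to `n` is kept; each of its
`n` coordinates has mass at least `r`. -/
theorem IsFactory.lintegral_outputAt_mul_le {A : XAlgorithm X} {f : ℝ → ℝ≥0}
    (hA : A.IsFactory f) (e₀ e₁ : X) (n : ℕ) (s : Finset ℕ) {p r : ℝ} (hp : p ∈ Icc (0 : ℝ) 1)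
    (h₀ : r ≤ 1 - p) (h₁ : r ≤ p) :
    (∫⁻ u, A.outputAt n u (twoValued e₀ e₁ s) ∂uniformUnit) * ENNReal.ofReal r ^ n ≤
      f ((1 - p) * e₀ + p * e₁) := by
  have := isProbabilityMeasure_twoPoint e₀ e₁ hp
  rw [← integral_twoPoint e₀ e₁ hp, ← hA _ (integrable_twoPoint e₀ e₁ p)]
  set π := twoPoint e₀ e₁ p
  set y := twoValued e₀ e₁ s
  set C : Set (ℕ → X) := Set.pi (Finset.range n) fun k => {y k}
  have hC : MeasurableSet C :=
    MeasurableSet.pi (Finset.range n).countable_toSet fun k _ => measurableSet_singleton _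
  have hmass : ENNReal.ofReal r ^ n ≤ Measure.infinitePi (fun _ : ℕ => π) C := by
    rw [Measure.infinitePi_pi _ fun k _ => measurableSet_singleton _]
    calc ENNReal.ofReal r ^ n = ∏ _k ∈ Finset.range n, ENNReal.ofReal r := by simp
      _ ≤ _ := Finset.prod_le_prod' fun k _ => le_twoPoint_singleton e₀ e₁ h₀ h₁ s k
  have hmeas : Measurable fun u => A.outputAt n u y :=
    (A.measurable_outputAt n).comp (measurable_id.prodMk measurable_const)
  calc (∫⁻ u, A.outputAt n u y ∂uniformUnit) * ENNReal.ofReal r ^ n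
      ≤ (∫⁻ u, A.outputAt n u y ∂uniformUnit) * Measure.infinitePi (fun _ : ℕ => π) C := by
        gcongr
    _ = ∫⁻ w, A.outputAt n w.1 y * C.indicator 1 w.2
          ∂(uniformUnit.prod (Measure.infinitePi fun _ : ℕ => π)) := by
        rw [lintegral_prod_mul hmeas.aemeasurable (measurable_one.indicator hC).aemeasurable,
          lintegral_indicator_one hC]
    _ ≤ ∫⁻ w, A.output w.1 w.2 ∂(uniformUnit.prod (Measure.infinitePi fun _ : ℕ => π)) := by
        refine lintegral_mono fun w => ?_
        by_cases hw : w.2 ∈ C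
        · simp only [indicator_of_mem hw, Pi.one_apply, mul_one]
          rw [← A.outputAt_congr w.1 fun k hk => hw k (by simpa using hk)]
          exact A.outputAt_le_output n w.1 w.2
        · simp [indicator_of_notMem hw]

theorem IsFactory.exists_le {a b : ℝ} (hab : a < b) {A : XAlgorithm (Icc a b)} {f : ℝ → ℝ≥0}
    (hA : A.IsFactory f) (hf0 : ∃ x ∈ Icc a b, f x ≠ 0) :
    ∃ ε : ℝ, 0 < ε ∧ ∃ n : ℕ, ∀ x ∈ Icc a b,
      ε * min ((x - a) ^ n) ((b - x) ^ n) ≤ (f x : ℝ) := by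
  have hba : 0 < b - a := sub_pos.2 hab
  let e₀ : Icc a b := ⟨a, left_mem_Icc.2 hab.le⟩
  let e₁ : Icc a b := ⟨b, right_mem_Icc.2 hab.le⟩
  have hmix : ∀ x : ℝ, (1 - (x - a) / (b - a)) * a + (x - a) / (b - a) * b = x := by
    intro x
    field_simp
    ring
  obtain ⟨z, hz, hfz⟩ := hf0
  obtain ⟨n, s, hns⟩ := hA.exists_lintegral_outputAt_ne_zero e₀ e₁
    (position_mem_unitInterval ⟨z, hz⟩) (by rwa [position, hmix z])
  -- Truncation at `1` makes the constant finite without a separate argument.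
  set c := min (∫⁻ u, A.outputAt n u (twoValued e₀ e₁ s) ∂uniformUnit) 1
  have hc0 : c ≠ 0 := by simp [c, hns]
  have hctop : c ≠ ∞ := ne_top_of_le_ne_top ENNReal.one_ne_top (min_le_right _ _)
  refine ⟨c.toReal / (b - a) ^ n, div_pos (ENNReal.toReal_pos hc0 hctop) (pow_pos hba n), n,
    fun x hx => ?_⟩
  set r := min (x - a) (b - x)
  have hr : 0 ≤ r := le_min (sub_nonneg.2 hx.1) (sub_nonneg.2 hx.2)
  have h := hA.lintegral_outputAt_mul_le e₀ e₁ n s (r := r / (b - a))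
    (position_mem_unitInterval ⟨x, hx⟩)
    (by
      rw [position, one_sub_div hba.ne']
      exact div_le_div_of_nonneg_right ((min_le_right _ _).trans (by simp)) hba.le)
    (div_le_div_of_nonneg_right (min_le_left _ _) hba.le)
  rw [position, hmix x] at h
  have h' : c * ENNReal.ofReal (r / (b - a)) ^ n ≤ f x :=
    (mul_le_mul_left (min_le_left _ _) _).trans h
  have h'' := ENNReal.toReal_mono ENNReal.coe_ne_top h'
  rw [ENNReal.toReal_mul, ENNReal.toReal_pow, ENNReal.toReal_ofReal (by positivity),
    ENNReal.coe_toReal, div_pow] at h''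
  have hmin : min ((x - a) ^ n) ((b - x) ^ n) ≤ r ^ n := by
    rcases min_choice (x - a) (b - x) with h | h <;> simp [r, h]
  calc c.toReal / (b - a) ^ n * min ((x - a) ^ n) ((b - x) ^ n)
      ≤ c.toReal / (b - a) ^ n * r ^ n := by gcongr
    _ = c.toReal * (r ^ n / (b - a) ^ n) := by ring
    _ ≤ f x := h''

end XAlgorithm

theorem theorem3 (a b : ℝ) (hab : a ≤ b) (f : ℝ → ℝ≥0)
    (hf : ContinuousOn f (Icc a b)) (hf0 : ∃ x ∈ Icc a b, f x ≠ 0) :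
    (∃ A : XAlgorithm (Icc a b), A.IsFactory f) ↔
      ∃ ε : ℝ, 0 < ε ∧ ∃ n : ℕ, ∀ x ∈ Icc a b,
        ε * min ((x - a) ^ n) ((b - x) ^ n) ≤ (f x : ℝ) := by
  constructor
  · rintro ⟨A, hA⟩
    rcases hab.eq_or_lt with rfl | hlt
    -- The exponent `1` makes the left side vanish at the only point; exponent `0` would not.
    · refine ⟨1, one_pos, 1, fun x hx => ?_⟩
      obtain rfl : a = x := hx.1.antisymm hx.2
      simp
    · exact hA.exists_le hlt hf0
  · rintro ⟨ε, hε, n, h⟩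
    exact exists_isFactory_of_le a b hab f hf hf0 ε hε n h
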